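/- Let $P$ be a filtered poset, that is, a partially ordered set that admits a strictly order-preserving map $P\to\mathbb{N}$. For $p\in P$ let $d(p)$ (the degree of $p$) be the largest $n$ such that there is a chain $p_0<p_1<\dots<p_n=p$ in $P$. For a subposet $S$ of $P_{<p}=\{q\in P\mid q<p\}$, say that $p$ closes a circuit in $S$ if some connected component of $S$ has at least two maximal elements (two elements of $S$ lie in the same connected component if they are joined by a finite sequence of elements of $S$ in which any two consecutive ones are comparable). The labelling function $B\colon P\to\mathbb{N}$ of $P$ is defined inductively as follows: $B(p)=0$ if $d(p)=0$, $B(p)=1$ if $d(p)=1$, and, if $d(p)\ge 2$, put \[ m=\max\{B(q)\mid q<p\},\qquad \mathcal{B}_p=\{s\in P_{<p}\mid m-1\le B(s)\le m\}, \] \[ B(p)=\begin{cases} m+1 & \text{if } p \text{ closes a circuit in } \mathcal{B}_p,\\ m & \text{otherwise.}\end{cases} \] (The maximum exists, since $B(q)\le d(q)$ for all $q$.) Let $R$ be a commutative ring with unit and let $F\colon P^{\mathrm{op}}\to R\text{-}\mathrm{Mod}$ be a functor, where $P$ is regarded as a category with exactly one morphism $p\to q$ whenever $p\le q$. Write $H^k(P;F)$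 for the $k$-th higher limit of $F$, i.e. the value at $F$ of the $k$-th right derived functor of $\lim\colon \mathrm{Fun}(P^{\mathrm{op}},R\text{-}\mathrm{Mod})\to R\text{-}\mathrm{Mod}$. Then \[ H^k(P;F)=0\qquad\text{for every integer } k \text{ with } k>\sup_{p\in P}B(p). \] -/

import Mathlib

open CategoryTheory CategoryTheory.Limits

universe u v

/-! ### Filtered posets, degrees and labels -/

/-- A poset is filtered if it admits a strictly order-preserving map to the natural numbers. -/
class FilteredPoset (P : Type u) [PartialOrder P] : Prop where
  exists_strictMono : ∃ d : P → ℕ, StrictMono d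

namespace FilteredPoset

variable {P : Type u} [PartialOrder P]

theorem height_ne_top [FilteredPoset P] (p : P) : Order.height p ≠ ⊤ := by
  obtain ⟨d, hd⟩ := exists_strictMono (P := P)
  have h : Order.height p ≤ Order.height (d p) := Order.height_le_height_apply_of_strictMono d hd p
  rw [Order.height_nat] at h
  exact ne_top_of_le_ne_top (ENat.natCast_ne_top _) h

instance [FilteredPoset P] : WellFoundedLT P := by
  obtain ⟨d, hd⟩ := exists_strictMono (P := P)
  exact hd.wellFoundedLT

/-- The degree of `p`: the largest `n` such that there is a chain `p₀ < p₁ < ⋯ < pₙ = p`.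
In a filtered poset this maximum exists, and is the value of `Order.height`. -/
noncomputable def degree (p : P) : ℕ := (Order.height p).toNat

theorem coe_degree [FilteredPoset P] (p : P) : (degree p : ℕ∞) = Order.height p :=
  ENat.natCast_toNat (height_ne_top p)

theorem degree_strictMono [FilteredPoset P] : StrictMono (degree : P → ℕ) := by
  intro p q h
  have := Order.height_strictMono h (height_ne_top p).lt_top
  rw [← coe_degree, ← coe_degree] at this
  exact_mod_cast this

/-- The element `p` closes a circuit in the subposet `S` of `P_{<p}` if some connected component
of `S` has at least two maximal elements. -/
def ClosesCircuit (p : P) (S : Set P) : Prop :=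
  S ⊆ Set.Iio p ∧
    ∃ c : ConnectedComponents S, {a : S | Quotient.mk'' a = c ∧ IsMax a}.Nontrivial

open Classical in
/-- The labelling function `B` of a filtered poset. Here `m` is the maximum of the labels of the
elements below `p` (it exists because labels are bounded by degrees, see `isGreatest_maxBelow`),
and `s` lies in the subposet `𝓑_p` if `s < p` and `m - 1 ≤ B s ≤ m`. -/
noncomputable def labelling [FilteredPoset P] (p : P) : ℕ :=
  if degree p = 0 then 0
  else if degree p = 1 then 1
  else
    let m : ℕ := sSup (Set.range fun q : Set.Iio p => labelling q.1)
    let S : Set P := Subtype.val '' {s : Set.Iio p | m ≤ labelling s.1 + 1 ∧ labelling s.1 ≤ m}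
    if ClosesCircuit p S then m + 1 else m
termination_by (wellFounded_lt (α := P)).wrap p
decreasing_by all_goals first | exact q.2 | exact s.2

/-- The maximum of the labels of the elements below `p`. -/
noncomputable def maxBelow [FilteredPoset P] (p : P) : ℕ := sSup (labelling '' Set.Iio p)

/-- The subposet of the elements `s < p` with `m - 1 ≤ B s ≤ m`, where `m = maxBelow p`. -/
def topLayers [FilteredPoset P] (p : P) : Set P :=
  {s | s < p ∧ maxBelow p ≤ labelling s + 1 ∧ labelling s ≤ maxBelow p}

theorem labelling_of_degree_zero [FilteredPoset P] {p : P} (h : degree p = 0) :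
    labelling p = 0 := by
  rw [labelling, if_pos h]

theorem labelling_of_degree_one [FilteredPoset P] {p : P} (h : degree p = 1) :
    labelling p = 1 := by
  rw [labelling, if_neg (by omega), if_pos h]

open Classical in
theorem labelling_of_two_le_degree [FilteredPoset P] {p : P} (h : 2 ≤ degree p) :
    labelling p = if ClosesCircuit p (topLayers p) then maxBelow p + 1 else maxBelow p := by
  have e : Set.range (fun q : Set.Iio p => labelling q.1) = labelling '' Set.Iio p := by
    ext; simp
  have e' : (Subtype.val '' {s : Set.Iio p |
      maxBelow p ≤ labelling s.1 + 1 ∧ labelling s.1 ≤ maxBelow p}) = topLayers p := by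
    ext; simp [topLayers]; tauto
  rw [labelling, if_neg (by omega), if_neg (by omega)]
  simp only [e]
  change (if ClosesCircuit p (Subtype.val '' {s : Set.Iio p |
      maxBelow p ≤ labelling s.1 + 1 ∧ labelling s.1 ≤ maxBelow p}) then _ else _) = _
  rw [e']
  rfl

theorem labelling_le_degree [FilteredPoset P] (p : P) : labelling p ≤ degree p := by
  induction p using WellFoundedLT.induction with
  | ind p ih =>
    rcases Nat.lt_or_ge (degree p) 2 with h | h
    · rcases Nat.lt_or_ge (degree p) 1 with h' | h'
      · rw [labelling_of_degree_zero (by omega)]; omega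
      · rw [labelling_of_degree_one (by omega)]; omega
    · have : maxBelow p ≤ degree p - 1 := by
        refine csSup_le' ?_
        rintro _ ⟨q, hq, rfl⟩
        have := ih q hq
        have := degree_strictMono (show q < p from hq)
        omega
      rw [labelling_of_two_le_degree h]
      split_ifs <;> omega

theorem isGreatest_maxBelow [FilteredPoset P] {p : P} (h : 1 ≤ degree p) :
    IsGreatest (labelling '' Set.Iio p) (maxBelow p) := by
  have hb : BddAbove (labelling '' Set.Iio p) := by
    refine ⟨degree p, ?_⟩
    rintro _ ⟨q, hq, rfl⟩
    exact (labelling_le_degree q).trans (degree_strictMono (show q < p from hq)).le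
  have hn : (labelling '' Set.Iio p).Nonempty := by
    rw [Set.image_nonempty]
    by_contra hc
    rw [Set.not_nonempty_iff_eq_empty, Set.Iio_eq_empty_iff] at hc
    have : Order.height p = 0 := Order.height_eq_zero.2 hc
    simp [degree, this] at h
  exact ⟨Nat.sSup_mem hn hb, fun _ hx => le_csSup hb hx⟩

end FilteredPoset

/-! ### Higher limits -/

namespace HigherLimit

variable {P : Type u} [PartialOrder P] {R : Type v} [CommRing R]

instance : EnoughInjectives (Discrete P ⥤ ModuleCat.{max u v} R) where
  presentation G := ⟨{
    J := Discrete.functor fun p => Injective.under (G.obj ⟨p⟩)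
    injective := ⟨fun {X Y} g f _ => ⟨Discrete.natTrans fun d =>
        Injective.factorThru (J := Injective.under (G.obj ⟨d.as⟩)) (g.app d) (f.app d), by
      ext1; funext d
      exact Injective.comp_factorThru (J := Injective.under (G.obj ⟨d.as⟩)) (g.app d) (f.app d)⟩⟩
    f := Discrete.natTrans fun d => Injective.ι (G.obj ⟨d.as⟩)
    mono := by
      rw [NatTrans.mono_iff_mono_app]
      intro d
      exact inferInstanceAs (Mono (Injective.ι (G.obj ⟨d.as⟩))) }⟩

instance : EnoughInjectives (Pᵒᵖ ⥤ ModuleCat.{max u v} R) := by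
  let L : Discrete P ⥤ Pᵒᵖ := Discrete.functor Opposite.op
  let W := (Functor.whiskeringLeft _ _ (ModuleCat.{max u v} R)).obj L
  have : W.Faithful := ⟨fun {X Y} f g h => by
    ext1; funext p
    exact congrArg (fun t => t.app ⟨p.unop⟩) h⟩
  exact EnoughInjectives.of_adjunction (L.ranAdjunction (ModuleCat.{max u v} R))

instance : (lim : (Pᵒᵖ ⥤ ModuleCat.{max u v} R) ⥤ ModuleCat.{max u v} R).Additive where
  map_add {F G f g} := by
    refine limit.hom_ext fun j => ?_
    simp [Preadditive.add_comp, Preadditive.comp_add]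

end HigherLimit

/-- The `k`-th higher limit `H^k(P; F)` of `F : Pᵒᵖ ⥤ ModuleCat R`: the value at `F` of the `k`-th
right derived functor of `lim : (Pᵒᵖ ⥤ ModuleCat R) ⥤ ModuleCat R`. -/
noncomputable def higherLimit {P : Type u} [PartialOrder P] {R : Type v} [CommRing R]
    (F : Pᵒᵖ ⥤ ModuleCat.{max u v} R) (k : ℕ) : ModuleCat.{max u v} R :=
  ((lim : (Pᵒᵖ ⥤ ModuleCat.{max u v} R) ⥤ ModuleCat.{max u v} R).rightDerived k).obj F

namespace HigherLimit

variable {P : Type u} [PartialOrder P] {R : Type v} [CommRing R]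

/-! ### Sections of presheaves on a poset over lower sets -/

/-! An injective resolution K of F consists of flasque functors, so the groups H^k(U) of sections of
K over lower sets U have the long exact sequences of pairs, and H^k(P) is the higher limit. By
well-founded induction on p, H^k(P_{<p}) = 0 for k ≥ B(p) (`acyclicOn_Iio`). Such vanishing in
degree k for all p ∈ U gives H^{k+1}(U) = 0, by extending primitives one point at a time. Hence
labels < n on U give H^k(U) = 0 for k ≥ n (`acyclicOn_of_labelling_lt`); with U = P this is the
theorem. For the induction, if B(p) exceeds every label below p, apply this to P_{<p}. Otherwise p
closes no circuit; the critical degree is B(p) = m + 1. Modulo W = {B < m}, the set P_{<p} is a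
disjoint union of cones, so its relative cohomology is a product over the cones and vanishes in that
degree, as does H^{m+1} of the part in W. -/

/-- The restriction map of a functor on `Pᵒᵖ` along `p ≤ q`. -/
def res (G : Pᵒᵖ ⥤ ModuleCat.{max u v} R) {p q : P} (h : p ≤ q) :
    G.obj (Opposite.op q) →ₗ[R] G.obj (Opposite.op p) :=
  (G.map (homOfLE h).op).hom

theorem res_self (G : Pᵒᵖ ⥤ ModuleCat.{max u v} R) {p : P} (h : p ≤ p)
    (x : G.obj (Opposite.op p)) : res G h x = x := by
  simp [res]

theorem res_res (G : Pᵒᵖ ⥤ ModuleCat.{max u v} R) {p q r : P} (h : p ≤ q) (h' : q ≤ r)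
    (x : G.obj (Opposite.op r)) : res G h (res G h' x) = res G (h.trans h') x := by
  have : (homOfLE (h.trans h')).op = (homOfLE h').op ≫ (homOfLE h).op := Subsingleton.elim _ _
  simp [res, this]

/-- A family of elements is a section over `U` if it is compatible with restriction from the
elements of `U`. -/
def IsSectionOn (G : Pᵒᵖ ⥤ ModuleCat.{max u v} R) (U : Set P)
    (s : ∀ p : P, G.obj (Opposite.op p)) : Prop :=
  ∀ ⦃q⦄, q ∈ U → ∀ ⦃p⦄ (h : p ≤ q), res G h (s q) = s p

theorem IsSectionOn.mono {G : Pᵒᵖ ⥤ ModuleCat.{max u v} R} {U V : Set P}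
    {s : ∀ p : P, G.obj (Opposite.op p)} (hs : IsSectionOn G V s) (h : U ⊆ V) :
    IsSectionOn G U s :=
  fun _ hq _ hpq => hs (h hq) hpq

theorem IsSectionOn.add {G : Pᵒᵖ ⥤ ModuleCat.{max u v} R} {U : Set P}
    {s t : ∀ p : P, G.obj (Opposite.op p)} (hs : IsSectionOn G U s) (ht : IsSectionOn G U t) :
    IsSectionOn G U (fun p => s p + t p) := by
  intro q hq p h
  rw [map_add, hs hq h, ht hq h]

theorem IsSectionOn.sub {G : Pᵒᵖ ⥤ ModuleCat.{max u v} R} {U : Set P}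
    {s t : ∀ p : P, G.obj (Opposite.op p)} (hs : IsSectionOn G U s) (ht : IsSectionOn G U t) :
    IsSectionOn G U (fun p => s p - t p) := by
  intro q hq p h
  rw [map_sub, hs hq h, ht hq h]

open Classical in
/-- An element of `G p` restricts to a section over the cone below `p`. -/
theorem exists_isSectionOn_Iic (G : Pᵒᵖ ⥤ ModuleCat.{max u v} R) {p : P}
    (x : G.obj (Opposite.op p)) :
    ∃ s, IsSectionOn G (Set.Iic p) s ∧ ∀ q (h : q ≤ p), s q = res G h x := by
  obtain ⟨s, hs⟩ : ∃ s : ∀ q, G.obj (Opposite.op q), ∀ q (h : q ≤ p), s q = res G h x :=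
    ⟨fun q => if h : q ≤ p then res G h x else 0, fun q h => dif_pos h⟩
  refine ⟨s, fun q hq r h => ?_, hs⟩
  have hq' : q ≤ p := hq
  rw [hs q hq', hs r (h.trans hq'), res_res]

/-- A functor is flasque if sections over lower sets extend to global sections. -/
def IsFlasque (G : Pᵒᵖ ⥤ ModuleCat.{max u v} R) : Prop :=
  ∀ (W : Set P), IsLowerSet W → ∀ s, IsSectionOn G W s →
    ∃ t, IsSectionOn G Set.univ t ∧ ∀ q ∈ W, t q = s q

/-- The constant functor with value `R`, extended by zero from the lower set `W`. -/
def extensionByZero (R : Type v) [CommRing R] (W : Set P) (hW : IsLowerSet W) :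
    Pᵒᵖ ⥤ ModuleCat.{max u v} R where
  obj q := ModuleCat.of R
    ({ carrier := {r | q.unop ∉ W → r = 0}
       add_mem' := fun ha hb h => by rw [ha h, hb h, add_zero]
       zero_mem' := fun _ => rfl
       smul_mem' := fun c _ hx h => by rw [hx h, smul_zero] } :
      Submodule R (ULift.{max u v} R))
  map f := ModuleCat.ofHom
    (Submodule.inclusion fun _ hr h => hr fun hq => h (hW (leOfHom f.unop) hq))

/-- A section over W is a map to `G` from the constant functor extended by zero, which embeds in the
full constant functor; injectivity extends the map. -/
theorem isFlasque_of_injective (G : Pᵒᵖ ⥤ ModuleCat.{max u v} R) [Injective G] :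
    IsFlasque G := by
  intro W hW s hs
  let A := extensionByZero R W hW
  let C := extensionByZero R (Set.univ : Set P) isLowerSet_univ
  let i : A ⟶ C :=
    { app := fun q => ModuleCat.ofHom (Submodule.inclusion fun r _ h => absurd trivial h) }
  have : Mono i := by
    rw [NatTrans.mono_iff_mono_app]
    intro q
    rw [ModuleCat.mono_iff_injective]
    exact Submodule.inclusion_injective (fun r _ h => absurd trivial h)
  let f : A ⟶ G :=
    { app := fun q => ModuleCat.ofHom
        ((LinearMap.toSpanSingleton R _ (s q.unop)).comp
          (ULift.moduleEquiv.toLinearMap.comp (Submodule.subtype _)))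
      naturality := by
        intro q p h
        ext ⟨r, hr⟩
        change r.down • s p.unop = res G (leOfHom h.unop) (r.down • s q.unop)
        by_cases hq : q.unop ∈ W
        · rw [map_smul, hs hq]
        · have : r = 0 := hr hq
          simp [this] }
  let g : C ⟶ G := Injective.factorThru f i
  have hg : i ≫ g = f := Injective.comp_factorThru f i
  let e : ∀ q : P, C.obj (Opposite.op q) := fun q => ⟨⟨1⟩, fun h => absurd trivial h⟩
  refine ⟨fun q => (g.app (Opposite.op q)).hom (e q), ?_, ?_⟩
  · intro q _ p h
    have := congrArg (fun t => t.hom (e q)) (g.naturality (homOfLE h).op)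
    exact this.symm
  · intro q hq
    have := congrArg (fun t => (t.app (Opposite.op q)).hom ⟨⟨1⟩, fun h => absurd hq h⟩) hg
    refine this.trans ?_
    change (1 : R) • s q = s q
    rw [one_smul]

/-! ### Cohomology of lower sets -/

section Complex

variable (K : CochainComplex (Pᵒᵖ ⥤ ModuleCat.{max u v} R) ℕ)

/-- The differential of a complex of functors at `p`. -/
def differential (i j : ℕ) (p : P) :
    (K.X i).obj (Opposite.op p) →ₗ[R] (K.X j).obj (Opposite.op p) :=
  ((K.d i j).app (Opposite.op p)).hom

theorem differential_differential (i j k : ℕ) (p : P) (x : (K.X i).obj (Opposite.op p)) :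
    differential K j k p (differential K i j p x) = 0 := by
  have := congrArg (fun t => (t.app (Opposite.op p)).hom x) (K.d_comp_d i j k)
  exact this

theorem res_differential (i j : ℕ) {p q : P} (h : p ≤ q) (x : (K.X i).obj (Opposite.op q)) :
    res (K.X j) h (differential K i j q x) = differential K i j p (res (K.X i) h x) := by
  have := congrArg (fun t => t.hom x) ((K.d i j).naturality (homOfLE h).op)
  exact this.symm

variable {K} in
theorem IsSectionOn.differential {i : ℕ} {U : Set P} {s : ∀ p : P, (K.X i).obj (Opposite.op p)}
    (hs : IsSectionOn (K.X i) U s) (j : ℕ) :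
    IsSectionOn (K.X j) U (fun p => differential K i j p (s p)) := by
  intro q hq p h
  rw [res_differential, hs hq h]

/-- The complex `K` of functors has no cohomology in degree `k` over `U`: every `k`-cocycle over
`U` is a coboundary. -/
def AcyclicOn (k : ℕ) (U : Set P) : Prop :=
  ∀ x, IsSectionOn (K.X k) U x → (∀ q ∈ U, differential K k (k + 1) q (x q) = 0) →
    ∃ y, IsSectionOn (K.X (k - 1)) U y ∧ ∀ q ∈ U, differential K (k - 1) k q (y q) = x q

/-- The complex `K` of functors has no relative cohomology in degree `k` of `V` modulo `W`. -/
def RelAcyclicOn (k : ℕ) (V W : Set P) : Prop :=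
  ∀ x, IsSectionOn (K.X k) V x → (∀ q ∈ V, differential K k (k + 1) q (x q) = 0) →
    (∀ q ∈ V ∩ W, x q = 0) →
    ∃ y, IsSectionOn (K.X (k - 1)) V y ∧ (∀ q ∈ V, differential K (k - 1) k q (y q) = x q) ∧
      ∀ q ∈ V ∩ W, y q = 0

theorem acyclicOn_empty (k : ℕ) : AcyclicOn K k ∅ :=
  fun _ _ _ => ⟨fun _ => 0, fun _ hq => absurd hq (Set.notMem_empty _),
    fun _ hq => absurd hq (Set.notMem_empty _)⟩

/-- The complex `K` of functors is exact at every element of `P` in positive degrees. -/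
def PointwiseExact : Prop :=
  ∀ (k : ℕ) (p : P) (x : (K.X (k + 1)).obj (Opposite.op p)),
    differential K (k + 1) (k + 2) p x = 0 → ∃ y, differential K k (k + 1) p y = x

variable {K}

/-- A section over a cone is determined by its value at the apex, so a primitive there suffices. -/
theorem PointwiseExact.acyclicOn_Iic (hK : PointwiseExact K) (k : ℕ) (p : P) :
    AcyclicOn K (k + 1) (Set.Iic p) := by
  intro x hx hdx
  obtain ⟨y, hy⟩ := hK k p (x p) (hdx p le_rfl)
  obtain ⟨s, hs, hsy⟩ := exists_isSectionOn_Iic (K.X k) y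
  refine ⟨s, hs, fun q hq => ?_⟩
  have hq' : q ≤ p := hq
  change differential K k (k + 1) q _ = _
  rw [hsy q hq', ← res_differential, hy, hx (Set.mem_Iic.2 le_rfl) hq']

/-- Relative acyclicity from the long exact sequence of a pair. -/
theorem AcyclicOn.relAcyclicOn (hK : ∀ k, IsFlasque (K.X k)) {k : ℕ} {V W : Set P}
    (hV : IsLowerSet V) (hW : IsLowerSet W) (h : AcyclicOn K (k + 1) V)
    (h' : AcyclicOn K k (V ∩ W)) : RelAcyclicOn K (k + 1) V W := by
  intro x hx hdx hxW
  obtain ⟨y, hy, hdy⟩ :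
      ∃ y, IsSectionOn (K.X k) V y ∧ ∀ q ∈ V, differential K k (k + 1) q (y q) = x q :=
    h x hx hdx
  -- Since x vanishes on V ∩ W, y is a cocycle there. Subtracting d of an extension of its primitive
  -- z makes y vanish on V ∩ W without changing dy.
  obtain ⟨z, hz, hdz⟩ := h' y (hy.mono Set.inter_subset_left) fun q hq =>
    (hdy q hq.1).trans (hxW q hq)
  obtain ⟨t, ht, htz⟩ := hK _ (V ∩ W) (hV.inter hW) z hz
  refine ⟨fun q => y q - differential K (k - 1) k q (t q),
    hy.sub ((ht.mono (Set.subset_univ V)).differential k), fun q hq => ?_, fun q hq => ?_⟩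
  · change differential K k (k + 1) q _ = _
    rw [map_sub, hdy q hq, differential_differential, sub_zero]
  · change y q - _ = 0
    rw [htz q hq, hdz q hq, sub_self]

/-- Exactness of H^k(V, W) → H^k(V) → H^k(V ∩ W) at the middle term. -/
theorem RelAcyclicOn.acyclicOn (hK : ∀ k, IsFlasque (K.X k)) {k : ℕ} {V W : Set P}
    (hV : IsLowerSet V) (hW : IsLowerSet W) (h : RelAcyclicOn K k V W)
    (h' : AcyclicOn K k (V ∩ W)) : AcyclicOn K k V := by
  intro x hx hdx
  obtain ⟨y, hy, hdy⟩ := h' x (hx.mono Set.inter_subset_left) fun q hq => hdx q hq.1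
  obtain ⟨t, ht, hty⟩ := hK _ (V ∩ W) (hV.inter hW) y hy
  have ht' := ht.mono (Set.subset_univ V)
  obtain ⟨z, hz, hdz, -⟩ := h (fun q => x q - differential K (k - 1) k q (t q))
    (hx.sub (ht'.differential k))
    (fun q hq => by rw [map_sub, hdx q hq, differential_differential, sub_zero])
    (fun q hq => by
      change x q - _ = 0
      rw [hty q hq, hdy q hq, sub_self])
  refine ⟨fun q => t q + z q, ht'.add hz, fun q hq => ?_⟩
  rw [map_add, hdz q hq, add_sub_cancel]

open Classical in
/-- Relative acyclicity is local if the lower set `V` is, away from `W`, a disjoint union of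
cones. -/
theorem relAcyclicOn_of_cones {k : ℕ} {V W : Set P} (hV : IsLowerSet V) (hW : IsLowerSet W)
    (c : P → P) (hcV : ∀ q ∈ V \ W, c q ∈ V) (hc : ∀ q ∈ V \ W, q ≤ c q)
    (hcc : ∀ q ∈ V \ W, ∀ p ∈ V \ W, p ≤ q → c p = c q)
    (h : ∀ q ∈ V \ W, RelAcyclicOn K k (Set.Iic (c q)) W) : RelAcyclicOn K k V W := by
  intro x hx hdx hxW
  have key : ∀ q ∈ V, q ∉ W → ∃ y, IsSectionOn (K.X (k - 1)) (Set.Iic (c q)) y ∧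
      (∀ r ∈ Set.Iic (c q), differential K (k - 1) k r (y r) = x r) ∧
      ∀ r ∈ Set.Iic (c q) ∩ W, y r = 0 := by
    intro q hq hq'
    have hsub : Set.Iic (c q) ⊆ V := fun r hr => hV hr (hcV q ⟨hq, hq'⟩)
    exact h q ⟨hq, hq'⟩ x (hx.mono hsub) (fun r hr => hdx r (hsub hr))
      (fun r hr => hxW r ⟨hsub hr.1, hr.2⟩)
  -- The primitive is chosen per apex, not per point, so that comparable points off W use the same
  -- one.
  have key' : ∀ a : P, ∃ y : ∀ r : P, (K.X (k - 1)).obj (Opposite.op r),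
      (∃ q ∈ V, q ∉ W ∧ c q = a) →
      IsSectionOn (K.X (k - 1)) (Set.Iic a) y ∧
      (∀ r ∈ Set.Iic a, differential K (k - 1) k r (y r) = x r) ∧
      ∀ r ∈ Set.Iic a ∩ W, y r = 0 := by
    intro a
    by_cases ha : ∃ q ∈ V, q ∉ W ∧ c q = a
    · obtain ⟨q, hq, hq', rfl⟩ := ha
      obtain ⟨y, hy⟩ := key q hq hq'
      exact ⟨y, fun _ => hy⟩
    · exact ⟨fun _ => 0, fun h => absurd h ha⟩
  choose y hy using key'
  refine ⟨fun q => if q ∈ W then 0 else y (c q) q, ?_, ?_, fun q hq => if_pos hq.2⟩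
  · intro q hq p hpq
    by_cases hqW : q ∈ W
    · simp only [if_pos hqW, if_pos (hW hpq hqW), map_zero]
    · obtain ⟨hy₁, -, hy₃⟩ := hy (c q) ⟨q, hq, hqW, rfl⟩
      have hqc := hc q ⟨hq, hqW⟩
      simp only [if_neg hqW]
      rw [hy₁ hqc hpq]
      by_cases hpW : p ∈ W
      · rw [if_pos hpW, hy₃ p ⟨hpq.trans hqc, hpW⟩]
      · rw [if_neg hpW, hcc q ⟨hq, hqW⟩ p ⟨hV hpq hq, hpW⟩ hpq]
  · intro q hq
    by_cases hqW : q ∈ W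
    · simp only [if_pos hqW, map_zero, hxW q ⟨hq, hqW⟩]
    · simp only [if_neg hqW]
      exact (hy (c q) ⟨q, hq, hqW, rfl⟩).2.1 q (hc q ⟨hq, hqW⟩)

/-- Solutions `y` of `d y = x` extend over a point `p` if the elements below `p` have no
cohomology one degree lower. -/
theorem AcyclicOn.exists_extension (hK : ∀ k, IsFlasque (K.X k)) (hK' : PointwiseExact K)
    {k : ℕ} {p : P} (h : AcyclicOn K k (Set.Iio p))
    (x : (K.X (k + 1)).obj (Opposite.op p)) (hdx : differential K (k + 1) (k + 2) p x = 0)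
    (y : ∀ q : P, (K.X k).obj (Opposite.op q)) (hy : IsSectionOn (K.X k) (Set.Iio p) y)
    (hdy : ∀ q (hq : q < p), differential K k (k + 1) q (y q) = res (K.X (k + 1)) hq.le x) :
    ∃ w : (K.X k).obj (Opposite.op p), differential K k (k + 1) p w = x ∧
      ∀ q (hq : q < p), res (K.X k) hq.le w = y q := by
  obtain ⟨w, hw⟩ := hK' k p x hdx
  obtain ⟨s, hs, hsw⟩ := exists_isSectionOn_Iic (K.X k) w
  -- Two primitives of x below p differ by a cocycle dz; extending z to p corrects w.
  obtain ⟨z, hz, hdz⟩ := h _ ((hs.mono Set.Iio_subset_Iic_self).sub hy) fun q hq => by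
    have hq' : q < p := hq
    rw [map_sub, hsw q hq'.le, ← res_differential, hw, hdy q hq', sub_self]
  obtain ⟨t, ht, htz⟩ := hK _ (Set.Iio p) (isLowerSet_Iio p) z hz
  refine ⟨w - differential K (k - 1) k p (t p), ?_, fun q hq => ?_⟩
  · rw [map_sub, differential_differential, hw, sub_zero]
  · rw [map_sub, res_differential, ht (Set.mem_univ p), htz q hq, hdz q hq, hsw q hq.le,
      sub_sub_cancel]

/-- If the sets `Iio p` for `p ∈ U` have no cohomology in degree `k`, then `U` has no cohomology
in degree `k + 1`. -/
theorem acyclicOn_of_forall_Iio [WellFoundedLT P] (hK : ∀ k, IsFlasque (K.X k))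
    (hK' : PointwiseExact K) {k : ℕ} {U : Set P} (hU : IsLowerSet U)
    (h : ∀ p ∈ U, AcyclicOn K k (Set.Iio p)) : AcyclicOn K (k + 1) U := by
  classical
  intro x hx hdx
  let Good (p : P) (y : ∀ q, q < p → (K.X k).obj (Opposite.op q))
      (w : (K.X k).obj (Opposite.op p)) : Prop :=
    differential K k (k + 1) p w = x p ∧ ∀ q (hq : q < p), res (K.X k) hq.le w = y q hq
  -- The default 0 is never taken on U, where an extension always exists.
  let step (p : P) (y : ∀ q, q < p → (K.X k).obj (Opposite.op q)) :
      (K.X k).obj (Opposite.op p) := if h : ∃ w, Good p y w then h.choose else 0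
  let y : ∀ p : P, (K.X k).obj (Opposite.op p) := (wellFounded_lt (α := P)).fix step
  have hy : ∀ p, y p = step p fun q _ => y q := fun p => WellFounded.fix_eq _ _ _
  have good : ∀ p, p ∈ U → Good p (fun q _ => y q) (y p) := by
    intro p
    induction p using WellFoundedLT.induction with
    | ind p ih =>
      intro hp
      have hex : ∃ w, Good p (fun q _ => y q) w := by
        refine (h p hp).exists_extension hK hK' (x p) (hdx p hp) y (fun q hq r hrq => ?_)
          fun q hq => ?_
        · rcases hrq.eq_or_lt with rfl | hlt
          · exact res_self _ _ _
          · exact (ih q hq (hU (le_of_lt hq) hp)).2 r hlt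
        · exact (ih q hq (hU hq.le hp)).1.trans (hx hp hq.le).symm
      rw [hy p]
      change Good p _ (if h : ∃ w, Good p _ w then h.choose else 0)
      rw [dif_pos hex]
      exact hex.choose_spec
  refine ⟨y, fun q hq p hpq => ?_, fun q hq => (good q hq).1⟩
  rcases hpq.eq_or_lt with rfl | hlt
  · exact res_self _ _ _
  · exact (good q hq).2 p hlt

end Complex

end HigherLimit

/-! ### Labels -/

namespace FilteredPoset

variable {P : Type u} [PartialOrder P] [FilteredPoset P]

theorem one_le_degree_of_lt {p q : P} (h : q < p) : 1 ≤ degree p := by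
  have := degree_strictMono h
  omega

theorem exists_degree_eq_of_lt {p : P} {n : ℕ} (h : n < degree p) : ∃ q < p, degree q = n := by
  have h' : (n : ℕ∞) < Order.height p := by
    rw [← coe_degree]
    exact_mod_cast h
  obtain ⟨q, hq, hqn⟩ := (Order.coe_lt_height_iff (height_ne_top p).lt_top).1 h'
  exact ⟨q, hq, by simp [degree, hqn]⟩

theorem labelling_le_maxBelow {p q : P} (h : q < p) : labelling q ≤ maxBelow p :=
  (isGreatest_maxBelow (one_le_degree_of_lt h)).2 ⟨q, h, rfl⟩

theorem maxBelow_le_labelling {p : P} (h : 2 ≤ degree p) : maxBelow p ≤ labelling p := by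
  rw [labelling_of_two_le_degree h]
  split_ifs <;> omega

theorem labelling_mono : Monotone (labelling : P → ℕ) := by
  intro q p h
  rcases h.eq_or_lt with rfl | h
  · rfl
  rcases Nat.lt_or_ge (degree p) 2 with hp | hp
  · have := labelling_le_degree q
    have := degree_strictMono h
    omega
  · exact (labelling_le_maxBelow h).trans (maxBelow_le_labelling hp)

/-- The case split of the main induction: a label fails to rise strictly only where no circuit is
closed. -/
theorem labelling_lt_or {p : P} :
    (∀ q < p, labelling q < labelling p) ∨
      (2 ≤ degree p ∧ ¬ ClosesCircuit p (topLayers p) ∧ labelling p = maxBelow p) := by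
  rcases Nat.lt_or_ge (degree p) 2 with hp | hp
  · refine Or.inl fun q hq => ?_
    have h₁ := labelling_le_degree q
    have h₂ := degree_strictMono hq
    have h₃ := labelling_of_degree_one (p := p) (by omega)
    omega
  · by_cases hc : ClosesCircuit p (topLayers p)
    · refine Or.inl fun q hq => ?_
      rw [labelling_of_two_le_degree hp, if_pos hc]
      exact Nat.lt_succ_of_le (labelling_le_maxBelow hq)
    · refine Or.inr ⟨hp, hc, ?_⟩
      rw [labelling_of_two_le_degree hp, if_neg hc]

theorem mem_topLayers_of_le {p q r : P} (hq : q ∈ topLayers p) (h : q ≤ r) (hr : r < p) :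
    r ∈ topLayers p :=
  ⟨hr, hq.2.1.trans (Nat.succ_le_succ (labelling_mono h)), labelling_le_maxBelow hr⟩

/-- Degrees below p are bounded, so an element of largest degree above q is maximal. -/
theorem exists_isMax_topLayers {p q : P} (hq : q ∈ topLayers p) :
    ∃ a : topLayers p, q ≤ a ∧ IsMax a := by
  have hb : BddAbove (degree '' {r | q ≤ r ∧ r < p}) := by
    refine ⟨degree p, ?_⟩
    rintro _ ⟨r, hr, rfl⟩
    exact (degree_strictMono hr.2).le
  obtain ⟨a, ⟨hqa, hap⟩, ha⟩ := Nat.sSup_mem (s := degree '' {r | q ≤ r ∧ r < p})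
    ⟨_, q, ⟨le_rfl, hq.1⟩, rfl⟩ hb
  refine ⟨⟨a, mem_topLayers_of_le hq hqa hap⟩, hqa, fun b hab => ?_⟩
  rcases (show a ≤ b from hab).eq_or_lt with h | h
  · exact h.ge
  · have h₁ := degree_strictMono h
    have h₂ := le_csSup hb ⟨b.1, ⟨hqa.trans h.le, b.2.1⟩, rfl⟩
    omega

/-- Maximal elements above a common q are joined through q, hence lie in one component. -/
theorem isMax_unique_of_not_closesCircuit {p : P} (h : ¬ ClosesCircuit p (topLayers p))
    {q : P} (hq : q ∈ topLayers p) {a b : topLayers p} (ha : IsMax a) (hb : IsMax b)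
    (hqa : q ≤ a) (hqb : q ≤ b) : a = b := by
  by_contra hab
  refine h ⟨fun s hs => hs.1, Quotient.mk'' b, a, ⟨?_, ha⟩, b, ⟨rfl, hb⟩, hab⟩
  let q' : topLayers p := ⟨q, hq⟩
  exact Quotient.sound (Zigzag.of_inv_hom (homOfLE (show q' ≤ a from hqa))
    (homOfLE (show q' ≤ b from hqb)))

end FilteredPoset

/-! ### Vanishing of the cohomology of P_{<p}. -/

namespace HigherLimit

open FilteredPoset

variable {P : Type u} [PartialOrder P] [FilteredPoset P] {R : Type v} [CommRing R]
  {K : CochainComplex (Pᵒᵖ ⥤ ModuleCat.{max u v} R) ℕ}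

theorem acyclicOn_of_labelling_lt (hK : ∀ k, IsFlasque (K.X k)) (hK' : PointwiseExact K)
    {n : ℕ} {U : Set P} (hU : IsLowerSet U) (hn : ∀ p ∈ U, labelling p < n)
    (h : ∀ p ∈ U, ∀ k, labelling p ≤ k → AcyclicOn K k (Set.Iio p)) {k : ℕ} (hk : n ≤ k) :
    AcyclicOn K k U := by
  rcases k with _ | k
  -- In degree 0, `k - 1` is 0 and d is zero, so acyclicity would mean that all 0-cocycles vanish; n
  -- = 0 forces U to be empty.
  · have : U = ∅ := Set.eq_empty_of_forall_notMem fun p hp => by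
      have := hn p hp
      omega
    exact this ▸ acyclicOn_empty K 0
  · refine acyclicOn_of_forall_Iio hK hK' hU fun p hp => h p hp k ?_
    have := hn p hp
    omega

theorem acyclicOn_Iio (hK : ∀ k, IsFlasque (K.X k)) (hK' : PointwiseExact K) (p : P) :
    ∀ k, labelling p ≤ k → AcyclicOn K k (Set.Iio p) := by
  induction p using WellFoundedLT.induction with
  | ind p ih =>
  intro k hk
  rcases labelling_lt_or (p := p) with h | ⟨hd, hc, hp⟩
  · exact acyclicOn_of_labelling_lt hK hK' (isLowerSet_Iio p) h ih hk
  rcases hk.lt_or_eq with hk | rfl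
  · exact acyclicOn_of_labelling_lt hK hK' (isLowerSet_Iio p)
      (fun q hq => Nat.lt_succ_of_le (hp ▸ labelling_le_maxBelow hq)) ih hk
  -- An element of degree 1 below p has label 1, so B(p) is positive.
  obtain ⟨m, hm⟩ : ∃ m, labelling p = m + 1 := by
    obtain ⟨q, hq, hq'⟩ := exists_degree_eq_of_lt (show 1 < degree p from hd)
    have := labelling_mono hq.le
    rw [labelling_of_degree_one hq'] at this
    exact ⟨labelling p - 1, by omega⟩
  let W : Set P := {q | labelling q < m}
  have hW : IsLowerSet W := fun q r hrq hq => (labelling_mono hrq).trans_lt hq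
  have hlow : ∀ V : Set P, IsLowerSet V → V ⊆ Set.Iio p → ∀ k, m ≤ k → AcyclicOn K k (V ∩ W) :=
    fun V hV hVp k hk => acyclicOn_of_labelling_lt hK hK' (hV.inter hW) (fun q hq => hq.2)
      (fun q hq => ih q (hVp hq.1)) hk
  have htop : ∀ q ∈ Set.Iio p \ W, q ∈ topLayers p := fun q hq =>
    ⟨hq.1, by have : ¬ labelling q < m := hq.2; omega, labelling_le_maxBelow hq.1⟩
  have hex : ∀ q, ∃ a, q ∈ Set.Iio p \ W → ∃ h : a ∈ topLayers p,
      q ≤ a ∧ IsMax (⟨a, h⟩ : topLayers p) := by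
    intro q
    by_cases hq : q ∈ Set.Iio p \ W
    · obtain ⟨a, ha⟩ := exists_isMax_topLayers (htop q hq)
      exact ⟨a, fun _ => ⟨a.2, ha⟩⟩
    · exact ⟨q, fun h => absurd h hq⟩
  choose c hc' using hex
  rw [hm]
  -- Off W everything lies in 𝓑_p, and c picks the unique maximal element above each point.
  refine RelAcyclicOn.acyclicOn hK (isLowerSet_Iio p) hW (relAcyclicOn_of_cones
    (isLowerSet_Iio p) hW c (fun q hq => (hc' q hq).1.1) (fun q hq => (hc' q hq).2.1)
    (fun q hq r hr hrq => ?_) fun q hq => ?_) (hlow _ (isLowerSet_Iio p) subset_rfl _ (by omega))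
  · obtain ⟨h₁, h₂, h₃⟩ := hc' q hq
    obtain ⟨h₄, h₅, h₆⟩ := hc' r hr
    exact congrArg Subtype.val
      (isMax_unique_of_not_closesCircuit hc (htop r hr) h₆ h₃ h₅ (hrq.trans h₂))
  -- The cone has no H^{m+1}, and its part in W, with labels below m, has no H^m.
  · exact (hK'.acyclicOn_Iic m _).relAcyclicOn hK (isLowerSet_Iic _) hW
      (hlow _ (isLowerSet_Iic _) (fun r hr => lt_of_le_of_lt hr (hc' q hq).1.1) m le_rfl)

end HigherLimit

/-! ### From global sections to derived functors of the limit. -/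

namespace HigherLimit

variable {P : Type u} [PartialOrder P] {R : Type v} [CommRing R]

theorem pointwiseExact_of_exactAt {K : CochainComplex (Pᵒᵖ ⥤ ModuleCat.{max u v} R) ℕ}
    (hK : ∀ k, K.ExactAt (k + 1)) : PointwiseExact K := by
  intro k p x hx
  have h := (K.exactAt_iff' k (k + 1) (k + 2) (by simp) (by simp)).1 (hK k)
  have h' := h.map ((evaluation Pᵒᵖ (ModuleCat.{max u v} R)).obj (Opposite.op p))
  rw [ShortComplex.moduleCat_exact_iff] at h'
  exact h' x hx

/-- Global sections are elements of the limit. -/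
theorem exists_limit_element (G : Pᵒᵖ ⥤ ModuleCat.{max u v} R)
    (s : ∀ p : P, G.obj (Opposite.op p)) (hs : IsSectionOn G Set.univ s) :
    ∃ x : (lim.obj G : ModuleCat.{max u v} R), ∀ p,
      (limit.π G (Opposite.op p)).hom x = s p := by
  let c : Cone G :=
    { pt := ModuleCat.of R (ULift.{max u v} R)
      π :=
        { app := fun q => ModuleCat.ofHom
            ((LinearMap.toSpanSingleton R _ (s q.unop)).comp ULift.moduleEquiv.toLinearMap)
          naturality := by
            intro q p h
            ext r
            change r.down • s p.unop = res G (leOfHom h.unop) (r.down • s q.unop)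
            rw [map_smul, hs (Set.mem_univ _)] } }
  refine ⟨(limit.lift G c).hom ⟨1⟩, fun p => ?_⟩
  have := congrArg (fun t => t.hom ⟨1⟩) (limit.lift_π c (Opposite.op p))
  refine this.trans ?_
  change (1 : R) • s p = s p
  rw [one_smul]

theorem exactAt_lim {K : CochainComplex (Pᵒᵖ ⥤ ModuleCat.{max u v} R) ℕ} {k : ℕ}
    (h : AcyclicOn K (k + 1) (Set.univ : Set P)) :
    (((lim : (Pᵒᵖ ⥤ ModuleCat.{max u v} R) ⥤ _).mapHomologicalComplex _).obj K).ExactAt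
      (k + 1) := by
  rw [HomologicalComplex.exactAt_iff' _ k (k + 1) (k + 2) (by simp) (by simp),
    ShortComplex.moduleCat_exact_iff]
  intro x hx
  have hπ : ∀ (i j : ℕ) (p : P) (z : (lim.obj (K.X i) : ModuleCat.{max u v} R)),
      (limit.π (K.X j) (Opposite.op p)).hom ((lim.map (K.d i j)).hom z) =
        differential K i j p ((limit.π (K.X i) (Opposite.op p)).hom z) := by
    intro i j p z
    have := congrArg (fun t => t.hom z) (limMap_π (K.d i j) (Opposite.op p))
    exact this
  obtain ⟨y, hy, hdy⟩ := h (fun p => (limit.π (K.X (k + 1)) (Opposite.op p)).hom x)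
    (fun q _ p hpq => by
      have := congrArg (fun t => t.hom x) (limit.w (K.X (k + 1)) (homOfLE hpq).op)
      exact this)
    (fun q _ => by
      exact (hπ (k + 1) (k + 2) q x).symm.trans ((congrArg _ hx).trans (map_zero _)))
  obtain ⟨z, hz⟩ := exists_limit_element (K.X k) y hy
  refine ⟨z, Concrete.limit_ext (K.X (k + 1)) _ _ fun p => ?_⟩
  refine (hπ k (k + 1) p.unop z).trans ?_
  rw [hz]
  exact hdy p.unop (Set.mem_univ _)

end HigherLimit

theorem mainTheorem3 {P : Type u} [PartialOrder P] [FilteredPoset P] {R : Type v} [CommRing R]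
    (F : Pᵒᵖ ⥤ ModuleCat.{max u v} R) (k : ℕ)
    (hk : (⨆ p : P, (FilteredPoset.labelling p : ℕ∞)) < (k : ℕ∞)) :
    IsZero (higherLimit.{u, v} F k) := by
  let I := InjectiveResolution.of F
  have hI : ∀ k, HigherLimit.IsFlasque (I.cocomplex.X k) := fun k =>
    HigherLimit.isFlasque_of_injective _
  have hI' := HigherLimit.pointwiseExact_of_exactAt fun k => I.cocomplex_exactAt_succ k
  have hlt : ∀ p : P, FilteredPoset.labelling p < k := fun p => by
    exact_mod_cast (le_iSup (fun p : P => (FilteredPoset.labelling p : ℕ∞)) p).trans_lt hk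
  -- k is positive even for empty P, where the supremum is 0.
  obtain ⟨k, rfl⟩ : ∃ n, k = n + 1 := Nat.exists_eq_succ_of_ne_zero fun h => by
    simp [h] at hk
  have h : HigherLimit.AcyclicOn I.cocomplex (k + 1) (Set.univ : Set P) :=
    HigherLimit.acyclicOn_of_labelling_lt hI hI' isLowerSet_univ (fun p _ => hlt p)
      (fun p _ => HigherLimit.acyclicOn_Iio hI hI' p) le_rfl
  exact (HigherLimit.exactAt_lim h).isZero_homology.of_iso (I.isoRightDerivedObj lim (k + 1))
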